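/- Let $\mathcal V=\{1,\dots,n\}$ and, for each $i\in\mathcal V$, let $X_i\subseteq\mathbb R^d$ be closed and convex and let $f_i:\mathbb R^d\to\mathbb R$ be lower semicontinuous on $X_i$ (which is automatic if $f_i$ is convex on $\mathbb R^d$) and strongly convex on $X_i$ with parameter $\theta_i>0$, i.e. $f_i(ax+by)\le af_i(x)+bf_i(y)-ab\frac{\theta_i}{2}\|x-y\|^2$ for all $x,y\in X_i$ and $a,b\ge 0$ with $a+b=1$. Assume $0\in\operatorname{int}\bigcap_{i}X_i$. For $\mathbf x=(x_1,\dots,x_n)\in\mathbb R^{nd}$ (with $x_i\in\mathbb R^d$) let $F(\mathbf x)=\sum_i f_i(x_i)$, let $S=\{\mathbf x: x_1=\dots=x_n\}$, let $S^\perp$ be its orthogonal complement and $P_{S^\perp}$ the orthogonal projection onto $S^\perp$. For $\mathbf w=(w_1,\dots,w_n)\in\mathbb R^{nd}$ let $D(\mathbf w)=\sum_i d_i(w_i)$ with $d_i(w_i)=\sup_{x\in X_i}\bigl(w_i^Tx-f_i(x)\bigr)$. For each $k\ge 0$ let $\mathcal G^k=(\mathcal V,\mathcal E^k)$ be an undirected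 simple graph, with $\mathcal N_i^k$ the set of neighbours of $i$, and assume that the graph on $\mathcal V$ whose edges are the pairs that belong to $\mathcal E^k$ for infinitely many $k$ is connected. Let $h^k_{ij}=h^k_{ji}$ for $\{i,j\}\in\mathcal E^k$, $k\ge0$, be weights in a fixed interval $[\underline h,\bar h]\subset(0,\infty)$, and let $H_{\mathcal G^k}$ be the $n\times n$ matrix with diagonal entries $\sum_{s\in\mathcal N_i^k}h^k_{is}$, entries $-h^k_{ij}$ for $\{i,j\}\in\mathcal E^k$, and zeros elsewhere. Let $\delta>0$ be such that $\delta\Lambda_L^{-1}-H_{\mathcal G^k}$ is positive semidefinite for all $k\ge 0$, where $\Lambda_L=\operatorname{diag}(1/\theta_1,\dots,1/\theta_n)$, and let the step-sizes satisfy $\alpha^k\in[\underline\alpha,\bar\alpha]\subset(0,2/\delta)$ for all $k\ge 0$. Let $(\mathbf w^k)$ and $(\mathbf x^k)$ be dual and primal iterates of the Fenchel dual gradient method, i.e. $\sum_i w_i^0=0$ and, for all $k\ge0$ and $i\in\mathcal V$, $$x_i^k=\operatorname*{arg\,max}_{x\in X_i}\bigl((w_i^k)^Tx-f_i(x)\bigr),\qquad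 w_i^{k+1}=w_i^k-\alpha^k\sum_{j\in\mathcal N_i^k}h_{ij}^k(x_i^k-x_j^k).$$ Then $\sum_i f_i$ has a unique minimizer $x^\star$ over $\bigcap_i X_i$; the minimum $F^\star$ of $F$ over $S\cap(X_1\times\dots\times X_n)$ and the minimum $D^\star$ of $D$ over $S^\perp$ exist; and, with $\mathbf x^\star=(x^\star,\dots,x^\star)$, as $k\to\infty$, $$\|P_{S^\perp}(\mathbf x^k)\|\to 0,\qquad D(\mathbf w^k)\to D^\star,\qquad F(\mathbf x^k)\to F^\star,\qquad \mathbf x^k\to\mathbf x^\star.$$ -/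

import Mathlib

open Filter Topology
open scoped InnerProductSpace

/-- The space `ℝ^d` of decisions of one agent, with the Euclidean norm. -/
abbrev Dec (d : ℕ) : Type := EuclideanSpace ℝ (Fin d)

/-- The space `ℝ^{nd}` of stacked vectors `(x_1, …, x_n)`, `x_i ∈ ℝ^d`, with the Euclidean norm. -/
abbrev Stacked (n d : ℕ) : Type := PiLp 2 (fun _ : Fin n => Dec d)

/-- The consensus subspace `S = {x : x_1 = ⋯ = x_n}`. -/
def consensus (n d : ℕ) : Submodule ℝ (Stacked n d) where
  carrier := {x | ∀ i j, x i = x j}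
  add_mem' := by
    intro a b ha hb i j
    simp only [PiLp.add_apply, ha i j, hb i j]
  zero_mem' := by
    intro i j
    simp only [PiLp.zero_apply]
  smul_mem' := by
    intro c a ha i j
    simp only [PiLp.smul_apply, ha i j]

/-- The stacked objective `F(x) = ∑ i, f_i(x_i)`. -/
noncomputable def primalObj {n d : ℕ} (f : Fin n → Dec d → ℝ) (x : Stacked n d) : ℝ :=
  ∑ i, f i (x i)

/-- The feasible set `{x : x_i ∈ X_i for all i, x ∈ S}` of the stacked problem. -/
def feasibleSet {n d : ℕ} (X : Fin n → Set (Dec d)) : Set (Stacked n d) :=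
  {x | (∀ i, x i ∈ X i) ∧ x ∈ consensus n d}

/-- The objective `q(x, w) = wᵀ x - f(x)`, to be maximized over `x`. -/
noncomputable def conjObj {d : ℕ} (f : Dec d → ℝ) (x w : Dec d) : ℝ :=
  ⟪w, x⟫_ℝ - f x

/-- The conjugate function `w ↦ sup_{x ∈ X} (wᵀ x - f(x))`. -/
noncomputable def conjFun {d : ℕ} (f : Dec d → ℝ) (X : Set (Dec d)) (w : Dec d) : ℝ :=
  ⨆ x : X, conjObj f x w

/-- The dual objective `D(w) = ∑ i, d_i(w_i)`, to be minimized over `Sᗮ`. -/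
noncomputable def dualObj {n d : ℕ} (f : Fin n → Dec d → ℝ) (X : Fin n → Set (Dec d))
    (w : Stacked n d) : ℝ :=
  ∑ i, conjFun (f i) (X i) (w i)

/-- The graph `(V, E_∞)` of the links that belong to `G k` for infinitely many `k`. -/
def infiniteLinks {n : ℕ} (G : ℕ → SimpleGraph (Fin n)) : SimpleGraph (Fin n) :=
  SimpleGraph.fromRel fun i j => ∃ᶠ k in atTop, (G k).Adj i j

open Classical in
/-- The weight matrix `H_G` of a graph `G` with link weights `h`. -/
noncomputable def weightMatrix {n : ℕ} (G : SimpleGraph (Fin n)) (h : Fin n → Fin n → ℝ) :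
    Matrix (Fin n) (Fin n) ℝ :=
  Matrix.of fun i j =>
    if i = j then ∑ s with G.Adj i s, h i s
    else if G.Adj i j then - h i j
    else 0

open Classical in
/-- `w` and `x` are dual and primal iterates of the Fenchel dual gradient method: the `w_i^0` sum
to zero, `x_i^k` maximizes `(w_i^k)ᵀ x - f_i(x)` over `X_i`, and
`w_i^{k+1} = w_i^k - α^k ∑_{j ∈ N_i^k} h_{ij}^k (x_i^k - x_j^k)`. -/
structure IsFenchelDualGradient {n d : ℕ} (f : Fin n → Dec d → ℝ) (X : Fin n → Set (Dec d))
    (G : ℕ → SimpleGraph (Fin n)) (h : ℕ → Fin n → Fin n → ℝ) (α : ℕ → ℝ)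
    (w x : ℕ → Stacked n d) : Prop where
  init : ∑ i, w 0 i = 0
  primal_mem : ∀ k i, x k i ∈ X i
  primal_max : ∀ k i, IsMaxOn (fun y => conjObj (f i) y (w k i)) (X i) (x k i)
  dual_step : ∀ k i,
    w (k + 1) i = w k i - α k • ∑ j with (G k).Adj i j, h k i j • (x k i - x k j)

/-! The dual objective `D` is convex and its gradient is the vector of maximizers `x_i`, which are
`1/θ_i`-Lipschitz in `w_i`. The iteration is thus a gradient method on `D`, preconditioned by the
graph Laplacian `H`. As `H ⪯ δ Λ_L⁻¹` and `α < 2/δ`, each step lowers `D` by a fixed multiple of the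
Laplacian energy of `x^k` (`IsFenchelDualGradient.dualObj_succ_add_le`). Since `0` is interior to
every `X_i`, `D` is coercive, so the dual iterates are bounded and have a cluster point `ŵ`, with
maximizers `x̂`.

The crux is that `x̂` is in consensus (`eq_of_clusterPt_of_connected`), although the waiting time
for a link is unbounded. While no active link joins nodes at which `x̂` differs, `∑ ⟪w_i, x̂_i⟫` is
frozen, and strong convexity then keeps `x^k` near `x̂` however long the wait. When such a link
appears, the decrease would push `D` below its limit.

Consensus turns `ŵ`, whose blocks sum to zero, into an optimal multiplier: `x̂ = (x⋆, …, x⋆)` is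
optimal and `D⋆ = -F⋆`. The same strong convexity bounds `∑ θ_i/2 ‖x_i^k - x⋆‖²` by `D(w^k) - D⋆`,
so the whole primal sequence converges; convergence of `w^k` is not needed. -/

/-! ### Conjugates of strongly convex functions -/

section Conjugate

variable {d : ℕ} {f : Dec d → ℝ} {X : Set (Dec d)} {θ : ℝ} {x y w w' x' : Dec d}

/-- Strong convexity makes the maximization of `conjObj f · w` sharp: the gap grows quadratically. -/
theorem StrongConvexOn.conjObj_add_le (hf : StrongConvexOn X θ f) (hx : x ∈ X)
    (hmax : IsMaxOn (fun y => conjObj f y w) X x) (hy : y ∈ X) :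
    conjObj f y w + θ / 2 * ‖y - x‖ ^ 2 ≤ conjObj f x w := by
  -- Compare `x` with points of the segment to `y` and cancel `t`; the loss factor `1 - t`
  -- disappears as `t → 0⁺`.
  have key : ∀ t ∈ Set.Ioo (0 : ℝ) 1,
      conjObj f y w + (1 - t) * (θ / 2 * ‖y - x‖ ^ 2) ≤ conjObj f x w := by
    rintro t ⟨ht0, ht1⟩
    have h1 := hf.2 hy hx ht0.le (sub_nonneg.2 ht1.le) (by ring)
    have h2 : conjObj f (t • y + (1 - t) • x) w ≤ conjObj f x w :=
      hmax (hf.1 hy hx ht0.le (sub_nonneg.2 ht1.le) (by ring))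
    simp only [conjObj, inner_add_right, inner_smul_right, smul_eq_mul] at h1 h2 ⊢
    have h3 : t * (⟪w, y⟫_ℝ - f y + (1 - t) * (θ / 2 * ‖y - x‖ ^ 2)) ≤
        t * (⟪w, x⟫_ℝ - f x) := by linarith
    exact le_of_mul_le_mul_left h3 ht0
  have hlim : Tendsto (fun t : ℝ => conjObj f y w + (1 - t) * (θ / 2 * ‖y - x‖ ^ 2)) (𝓝[>] 0)
      (𝓝 (conjObj f y w + θ / 2 * ‖y - x‖ ^ 2)) := by
    have : Continuous fun t : ℝ => conjObj f y w + (1 - t) * (θ / 2 * ‖y - x‖ ^ 2) := by fun_prop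
    simpa using this.continuousWithinAt (s := Set.Ioi 0) (x := 0) |>.tendsto
  exact le_of_tendsto hlim (eventually_of_mem (Ioo_mem_nhdsGT one_pos) key)

theorem conjObj_eq_add_inner (f : Dec d → ℝ) (y w w' : Dec d) :
    conjObj f y w' = conjObj f y w + ⟪w' - w, y⟫_ℝ := by
  simp only [conjObj, inner_sub_left]; ring

/-- The descent inequality of the conjugate function, whose gradient is `1 / θ`-Lipschitz. -/
theorem StrongConvexOn.conjObj_le_add_sq (hθ : 0 < θ) (hf : StrongConvexOn X θ f) (hx : x ∈ X)
    (hmax : IsMaxOn (fun y => conjObj f y w) X x) (hy : y ∈ X) (w' : Dec d) :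
    conjObj f y w' ≤ conjObj f x w + ⟪w' - w, x⟫_ℝ + 1 / (2 * θ) * ‖w' - w‖ ^ 2 := by
  have h1 := hf.conjObj_add_le hx hmax hy
  have h2 : ⟪w' - w, y⟫_ℝ = ⟪w' - w, x⟫_ℝ + ⟪w' - w, y - x⟫_ℝ := by
    rw [inner_sub_right]; ring
  have h3 := real_inner_le_norm (w' - w) (y - x)
  have h4 : ‖w' - w‖ * ‖y - x‖ ≤ θ / 2 * ‖y - x‖ ^ 2 + 1 / (2 * θ) * ‖w' - w‖ ^ 2 := by
    have : θ / 2 * ‖y - x‖ ^ 2 + 1 / (2 * θ) * ‖w' - w‖ ^ 2 - ‖w' - w‖ * ‖y - x‖ =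
        1 / (2 * θ) * (θ * ‖y - x‖ - ‖w' - w‖) ^ 2 := by field_simp; ring
    have : 0 ≤ 1 / (2 * θ) * (θ * ‖y - x‖ - ‖w' - w‖) ^ 2 := by positivity
    linarith
  rw [conjObj_eq_add_inner f y w w', h2]
  linarith

/-- The maximizer of `conjObj f · w` is a `1 / θ`-Lipschitz function of `w`. -/
theorem StrongConvexOn.norm_sub_le_of_isMaxOn (hf : StrongConvexOn X θ f)
    (hx : x ∈ X) (hmax : IsMaxOn (fun y => conjObj f y w) X x)
    (hx' : x' ∈ X) (hmax' : IsMaxOn (fun y => conjObj f y w') X x') :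
    θ * ‖x' - x‖ ≤ ‖w' - w‖ := by
  -- The sum of the two sharp bounds is strong monotonicity, `θ ‖x' - x‖² ≤ ⟪w' - w, x' - x⟫`;
  -- Cauchy–Schwarz finishes.
  have h1 := hf.conjObj_add_le hx hmax hx'
  have h2 := hf.conjObj_add_le hx' hmax' hx
  rw [conjObj_eq_add_inner f x w w', conjObj_eq_add_inner f x' w w', norm_sub_rev x x'] at h2
  have h3 := real_inner_le_norm (w' - w) (x' - x)
  rw [inner_sub_right] at h3
  rcases (norm_nonneg (x' - x)).eq_or_lt with h0 | h0
  · rw [← h0]; simp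
  · refine le_of_mul_le_mul_right ?_ h0
    nlinarith

theorem bddAbove_range_conjObj (hθ : 0 < θ) (hf : StrongConvexOn X θ f) (hx : x ∈ X)
    (hmax : IsMaxOn (fun y => conjObj f y w) X x) (w' : Dec d) :
    BddAbove (Set.range fun y : X => conjObj f y w') :=
  ⟨_, Set.forall_mem_range.2 fun y => hf.conjObj_le_add_sq hθ hx hmax y.2 w'⟩

theorem conjFun_eq_of_isMaxOn (hx : x ∈ X) (hmax : IsMaxOn (fun y => conjObj f y w) X x) :
    conjFun f X w = conjObj f x w := by
  have : Nonempty X := ⟨⟨x, hx⟩⟩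
  refine le_antisymm (ciSup_le fun y => hmax y.2) ?_
  exact le_ciSup (f := fun y : X => conjObj f y w)
    ⟨conjObj f x w, Set.forall_mem_range.2 fun y => hmax y.2⟩ ⟨x, hx⟩

/-- The conjugate of a convex function is coercive if the origin is interior to the domain. -/
theorem ConvexOn.exists_mul_norm_sub_le_conjObj (hf : ConvexOn ℝ X f) (h0 : (0 : Dec d) ∈ interior X) :
    ∃ r > 0, ∃ M : ℝ, ∀ w x, IsMaxOn (fun y => conjObj f y w) X x →
      r * ‖w‖ - M ≤ conjObj f x w := by
  have hcont : ContinuousAt f 0 := hf.continuousOn_interior.continuousAt (isOpen_interior.mem_nhds h0)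
  have hev : ∀ᶠ y in 𝓝 (0 : Dec d), f y < f 0 + 1 ∧ y ∈ X :=
    (hcont.eventually_lt continuousAt_const (by simp)).and (mem_interior_iff_mem_nhds.1 h0)
  obtain ⟨r, hr, hball⟩ := Metric.eventually_nhds_iff.1 hev
  refine ⟨r / 2, by positivity, f 0 + 1, fun w x hmax => ?_⟩
  rcases eq_or_ne w 0 with rfl | hw
  · have h1 := hball (y := 0) (by simpa using hr)
    have h2 : conjObj f 0 0 ≤ conjObj f x 0 := hmax h1.2
    simp only [conjObj, inner_zero_left, norm_zero] at h2 ⊢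
    linarith [h1.1]
  · have hw' : ‖w‖ ≠ 0 := norm_ne_zero_iff.2 hw
    -- Test point in the direction of `w`; radius `r / 2` keeps it strictly inside the ball.
    have h1 := hball (y := (r / 2 / ‖w‖) • w) (by
      rw [dist_zero_right, norm_smul, Real.norm_of_nonneg (by positivity),
        div_mul_cancel₀ _ hw']
      linarith)
    have h2 : conjObj f ((r / 2 / ‖w‖) • w) w ≤ conjObj f x w := hmax h1.2
    have h3 : ⟪w, (r / 2 / ‖w‖) • w⟫_ℝ = r / 2 * ‖w‖ := by
      rw [inner_smul_right, real_inner_self_eq_norm_sq]; field_simp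
    have h4 : conjObj f ((r / 2 / ‖w‖) • w) w = r / 2 * ‖w‖ - f ((r / 2 / ‖w‖) • w) := by
      rw [conjObj, h3]
    linarith [h1.1]

/-- The graph of the maximizer map is closed. -/
theorem LowerSemicontinuousOn.isMaxOn_conjObj_of_tendsto (hX : IsClosed X)
    (hf : LowerSemicontinuousOn f X) {u v : ℕ → Dec d} (hv : ∀ k, v k ∈ X)
    (hmax : ∀ k, IsMaxOn (fun y => conjObj f y (u k)) X (v k))
    (hu : Tendsto u atTop (𝓝 w)) (hvx : Tendsto v atTop (𝓝 x)) :
    x ∈ X ∧ IsMaxOn (fun y => conjObj f y w) X x := by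
  have hxX : x ∈ X := hX.mem_of_tendsto hvx (Eventually.of_forall hv)
  refine ⟨hxX, fun y hy => ?_⟩
  -- Maximality bounds `f (v k)` above by this convergent sequence, so lower semicontinuity at `x`
  -- suffices.
  have hlim : Tendsto (fun k => f y + ⟪u k, v k - y⟫_ℝ) atTop (𝓝 (f y + ⟪w, x - y⟫_ℝ)) :=
    tendsto_const_nhds.add (hu.inner (hvx.sub_const y))
  have hle : f x ≤ f y + ⟪w, x - y⟫_ℝ := by
    refine le_of_forall_lt fun c hc => ?_
    by_contra! hcon
    obtain ⟨e, he1, he2⟩ := exists_between hc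
    have hev := (tendsto_nhdsWithin_iff.2 ⟨hvx, Eventually.of_forall hv⟩).eventually
      (hf x hxX e he2)
    have hev' := hlim.eventually_lt_const (lt_of_le_of_lt hcon he1)
    obtain ⟨k, hk1, hk2⟩ := (hev.and hev').exists
    have hk3 : conjObj f y (u k) ≤ conjObj f (v k) (u k) := hmax k hy
    simp only [conjObj] at hk3
    rw [inner_sub_right] at hk2
    linarith
  simp only [Set.mem_ofPred_eq, conjObj]
  rw [inner_sub_right] at hle
  linarith

end Conjugate

/-! ### Quadratic forms of weighted graph Laplacians -/

section Laplacian

variable {ι : Type*} [Fintype ι] {E : Type*} [NormedAddCommGroup E] [InnerProductSpace ℝ E]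

/-- The bilinear form `½ ∑ i j, a i j ⟪u i - u j, v i - v j⟫` of the weighted graph Laplacian. -/
noncomputable def laplacianForm (a : ι → ι → ℝ) (u v : ι → E) : ℝ :=
  2⁻¹ * ∑ i, ∑ j, a i j * ⟪u i - u j, v i - v j⟫_ℝ

/-- Summation by parts: exchanging `i` and `j` flips the sign of `u i - u j` and keeps the weight.
-/
theorem sum_inner_laplacian {a : ι → ι → ℝ} (ha : ∀ i j, a i j = a j i) (u v : ι → E) :
    ∑ i, ⟪∑ j, a i j • (u i - u j), v i⟫_ℝ = laplacianForm a u v := by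
  have h1 : ∑ i, ⟪∑ j, a i j • (u i - u j), v i⟫_ℝ =
      ∑ i, ∑ j, a i j * ⟪u i - u j, v i⟫_ℝ := by
    simp only [sum_inner, real_inner_smul_left]
  have h2 : ∑ i, ∑ j, a i j * ⟪u i - u j, v j⟫_ℝ = -∑ i, ∑ j, a i j * ⟪u i - u j, v i⟫_ℝ := by
    rw [Finset.sum_comm, ← Finset.sum_neg_distrib]
    refine Finset.sum_congr rfl fun i _ => ?_
    rw [← Finset.sum_neg_distrib]
    refine Finset.sum_congr rfl fun j _ => ?_
    rw [ha j i, ← neg_sub (u i) (u j), inner_neg_left]; ring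
  rw [h1, laplacianForm]
  simp only [inner_sub_right _ (v _) (v _), mul_sub, Finset.sum_sub_distrib]
  rw [h2]; ring

theorem laplacianForm_self (a : ι → ι → ℝ) (u : ι → E) :
    laplacianForm a u u = 2⁻¹ * ∑ i, ∑ j, a i j * ‖u i - u j‖ ^ 2 := by
  simp only [laplacianForm, real_inner_self_eq_norm_sq]

theorem laplacianForm_self_nonneg {a : ι → ι → ℝ} (ha : ∀ i j, 0 ≤ a i j) (u : ι → E) :
    0 ≤ laplacianForm a u u := by
  rw [laplacianForm_self]
  exact mul_nonneg (by norm_num) (Finset.sum_nonneg fun i _ => Finset.sum_nonneg fun j _ =>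
    mul_nonneg (ha i j) (sq_nonneg _))

theorem le_laplacianForm_self {a : ι → ι → ℝ} (ha : ∀ i j, 0 ≤ a i j) (u : ι → E) (i j : ι) :
    2⁻¹ * (a i j * ‖u i - u j‖ ^ 2) ≤ laplacianForm a u u := by
  rw [laplacianForm_self]
  have h0 : ∀ i j, 0 ≤ a i j * ‖u i - u j‖ ^ 2 := fun i j => mul_nonneg (ha i j) (sq_nonneg _)
  refine mul_le_mul_of_nonneg_left ?_ (by norm_num)
  exact (Finset.single_le_sum (fun j _ => h0 i j) (Finset.mem_univ j)).trans
    (Finset.single_le_sum (f := fun i => ∑ j, a i j * ‖u i - u j‖ ^ 2)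
      (fun i _ => Finset.sum_nonneg fun j _ => h0 i j) (Finset.mem_univ i))

theorem laplacianForm_sub_smul_self (a : ι → ι → ℝ) (u v : ι → E) (s : ℝ) :
    laplacianForm a (u - s • v) (u - s • v) =
      laplacianForm a u u - 2 * s * laplacianForm a u v + s ^ 2 * laplacianForm a v v := by
  simp only [laplacianForm, Finset.mul_sum, ← Finset.sum_add_distrib, ← Finset.sum_sub_distrib]
  refine Finset.sum_congr rfl fun i _ => Finset.sum_congr rfl fun j _ => ?_
  have : (u - s • v) i - (u - s • v) j = (u i - u j) - s • (v i - v j) := by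
    simp only [Pi.sub_apply, Pi.smul_apply, smul_sub]; abel
  rw [this]
  generalize u i - u j = p
  generalize v i - v j = q
  simp only [inner_sub_left, inner_sub_right, real_inner_smul_left, real_inner_smul_right,
    real_inner_comm p q]
  ring

/-- If `H ⪯ δ Θ` for a weighted Laplacian `H` and a positive diagonal `Θ`, then
`H Θ⁻¹ H ⪯ δ H`. -/
theorem sum_norm_sq_laplacian_le {a : ι → ι → ℝ} (hsymm : ∀ i j, a i j = a j i)
    (ha : ∀ i j, 0 ≤ a i j) {θ : ι → ℝ} (hθ : ∀ i, 0 < θ i) {δ : ℝ} (hδ : 0 < δ)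
    (hle : ∀ v : ι → E, laplacianForm a v v ≤ δ * ∑ i, θ i * ‖v i‖ ^ 2) (u : ι → E) :
    ∑ i, (θ i)⁻¹ * ‖∑ j, a i j • (u i - u j)‖ ^ 2 ≤ δ * laplacianForm a u u := by
  set g : ι → E := fun i => ∑ j, a i j • (u i - u j) with hg
  set v : ι → E := fun i => (θ i)⁻¹ • g i with hv
  set A := ∑ i, (θ i)⁻¹ * ‖g i‖ ^ 2 with hA
  have h1 : laplacianForm a u v = A := by
    rw [← sum_inner_laplacian hsymm]
    refine Finset.sum_congr rfl fun i _ => ?_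
    rw [hv, real_inner_smul_right, ← real_inner_self_eq_norm_sq]
  have h2 : laplacianForm a v v ≤ δ * A := by
    refine (hle v).trans_eq ?_
    congr 1
    refine Finset.sum_congr rfl fun i _ => ?_
    have := (hθ i).ne'
    rw [hv, norm_smul, Real.norm_of_nonneg (inv_nonneg.2 (hθ i).le)]
    field_simp
  -- The coefficient `δ⁻¹` minimizes `-2 s A + s² δ A` over `s`.
  have h3 := laplacianForm_self_nonneg ha (u - δ⁻¹ • v)
  rw [laplacianForm_sub_smul_self, h1] at h3
  have h4 : δ⁻¹ ^ 2 * laplacianForm a v v ≤ δ⁻¹ ^ 2 * (δ * A) := by gcongr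
  have h5 : δ⁻¹ ^ 2 * (δ * A) = δ⁻¹ * A := by field_simp
  have h6 : δ⁻¹ * A ≤ laplacianForm a u u := by linarith
  rwa [inv_mul_le_iff₀ hδ] at h6

end Laplacian

/-! ### From the matrix `H_G` to the Laplacian form -/

section WeightMatrix

open Classical in
/-- The weights of the links of `G`, extended by zero to all pairs of nodes. -/
noncomputable def linkWeight {n : ℕ} (G : SimpleGraph (Fin n)) (h : Fin n → Fin n → ℝ)
    (i j : Fin n) : ℝ :=
  if G.Adj i j then h i j else 0

variable {n : ℕ} {G : SimpleGraph (Fin n)} {h : Fin n → Fin n → ℝ}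

theorem linkWeight_symm (hsymm : ∀ i j, G.Adj i j → h i j = h j i) (i j : Fin n) :
    linkWeight G h i j = linkWeight G h j i := by
  unfold linkWeight
  by_cases hij : G.Adj i j
  · rw [if_pos hij, if_pos hij.symm, hsymm i j hij]
  · rw [if_neg hij, if_neg fun hji => hij hji.symm]

theorem linkWeight_nonneg (hnn : ∀ i j, G.Adj i j → 0 ≤ h i j) (i j : Fin n) :
    0 ≤ linkWeight G h i j := by
  unfold linkWeight
  split_ifs with hij
  exacts [hnn i j hij, le_rfl]

theorem weightMatrix_mulVec (v : Fin n → ℝ) (i : Fin n) :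
    (weightMatrix G h).mulVec v i = ∑ j, linkWeight G h i j • (v i - v j) := by
  classical
  have hdiag : weightMatrix G h i i = ∑ j, linkWeight G h i j := by
    simp only [weightMatrix, Matrix.of_apply, if_true, linkWeight, Finset.sum_filter]
  -- Degree matrix minus adjacency weights; valid on the diagonal too, since a simple graph has no
  -- loops.
  have hoff : ∀ j, weightMatrix G h i j =
      (if i = j then ∑ s, linkWeight G h i s else 0) - linkWeight G h i j := by
    intro j
    rcases eq_or_ne i j with rfl | hij
    · rw [hdiag, if_pos rfl]; simp [linkWeight]
    · rw [if_neg hij]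
      simp only [weightMatrix, Matrix.of_apply, if_neg hij, linkWeight]
      split_ifs <;> simp
  simp only [Matrix.mulVec, dotProduct, hoff, sub_mul, Finset.sum_sub_distrib, ite_mul, zero_mul,
    Finset.sum_ite_eq, Finset.mem_univ, if_true, smul_eq_mul, mul_sub, Finset.sum_mul]

/-- Both sides split over the `d` coordinates, and on each the claim is the scalar matrix
inequality. -/
theorem laplacianForm_linkWeight_le {d : ℕ} (hsymm : ∀ i j, G.Adj i j → h i j = h j i)
    {θ : Fin n → ℝ} (hθ : ∀ i, 0 < θ i) {δ : ℝ}
    (hδ : (δ • (Matrix.diagonal fun i => 1 / θ i)⁻¹ - weightMatrix G h).PosSemidef)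
    (v : Fin n → Dec d) :
    laplacianForm (linkWeight G h) v v ≤ δ * ∑ i, θ i * ‖v i‖ ^ 2 := by
  have hinv : (Matrix.diagonal fun i => 1 / θ i)⁻¹ = Matrix.diagonal θ := by
    refine Matrix.inv_eq_left_inv ?_
    rw [Matrix.diagonal_mul_diagonal, ← Matrix.diagonal_one]
    congr 1
    funext i
    have := (hθ i).ne'
    field_simp
  rw [hinv] at hδ
  have hscalar : ∀ u : Fin n → ℝ,
      laplacianForm (linkWeight G h) u u ≤ δ * ∑ i, θ i * u i ^ 2 := by
    intro u
    have h1 := hδ.dotProduct_mulVec_nonneg u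
    rw [Matrix.sub_mulVec, dotProduct_sub, Matrix.smul_mulVec, dotProduct_smul] at h1
    have h2 : star u ⬝ᵥ (weightMatrix G h).mulVec u = laplacianForm (linkWeight G h) u u := by
      rw [← sum_inner_laplacian (linkWeight_symm hsymm)]
      simp only [dotProduct, weightMatrix_mulVec]
      rfl
    have h3 : star u ⬝ᵥ (Matrix.diagonal θ).mulVec u = ∑ i, θ i * u i ^ 2 := by
      simp only [dotProduct, Matrix.mulVec_diagonal]
      refine Finset.sum_congr rfl fun i _ => ?_
      simp; ring
    rw [h2, h3, smul_eq_mul] at h1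
    linarith
  have h4 : laplacianForm (linkWeight G h) v v =
      ∑ l, laplacianForm (linkWeight G h) (fun i => v i l) (fun i => v i l) := by
    simp only [laplacianForm_self, EuclideanSpace.norm_sq_eq, Finset.mul_sum, PiLp.sub_apply]
    rw [eq_comm, Finset.sum_comm]
    exact Finset.sum_congr rfl fun i _ => Finset.sum_comm
  have h5 : δ * ∑ i, θ i * ‖v i‖ ^ 2 = ∑ l, δ * ∑ i, θ i * (v i l) ^ 2 := by
    simp only [EuclideanSpace.norm_sq_eq, Finset.mul_sum, Real.norm_eq_abs, sq_abs]
    rw [Finset.sum_comm]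
  rw [h4, h5]
  exact Finset.sum_le_sum fun l _ => hscalar _

end WeightMatrix

/-! ### Consensus and infinite connectivity -/

theorem mem_orthogonal_consensus_iff {n d : ℕ} {w : Stacked n d} :
    w ∈ (consensus n d)ᗮ ↔ ∑ i, w i = 0 := by
  rw [Submodule.mem_orthogonal]
  constructor
  · intro hw
    -- Testing against the constant vector with block `∑ i, w i` yields the squared norm of that
    -- sum.
    have h1 := hw (WithLp.toLp 2 fun _ => ∑ i, w i) (fun _ _ => rfl)
    rw [PiLp.inner_apply, ← inner_sum] at h1
    exact inner_self_eq_zero.1 h1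
  · intro hw u hu
    rw [PiLp.inner_apply]
    rcases isEmpty_or_nonempty (Fin n) with _ | ⟨⟨i0⟩⟩
    · simp
    · rw [Finset.sum_congr rfl fun i _ => by rw [hu i i0], ← inner_sum, hw, inner_zero_right]

theorem SimpleGraph.Connected.eq_of_forall_adj {V β : Type*} {G : SimpleGraph V} (hG : G.Connected)
    {c : V → β} (hc : ∀ i j, G.Adj i j → c i = c j) (i j : V) : c i = c j := by
  obtain ⟨p⟩ := hG.preconnected i j
  induction p with
  | nil => rfl
  | cons hadj _ ih => exact (hc _ _ hadj).trans ih

theorem frequently_adj_of_infiniteLinks_adj {n : ℕ} {G : ℕ → SimpleGraph (Fin n)} {i j : Fin n}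
    (hij : (infiniteLinks G).Adj i j) : ∃ᶠ k in atTop, (G k).Adj i j := by
  rcases ((SimpleGraph.fromRel_adj _ _ _).1 hij).2 with h1 | h1
  · exact h1
  · exact h1.mono fun k hk => hk.symm

/-- Distinct values of a function on a finite type are uniformly separated. -/
theorem exists_pos_le_norm_sub {ι E : Type*} [Finite ι] [NormedAddCommGroup E] (c : ι → E) :
    ∃ ε > 0, ∀ i j, c i ≠ c j → ε ≤ ‖c i - c j‖ := by
  have hfin : (Set.range c).Finite := Set.finite_range c
  rcases (Set.range c).subsingleton_or_nontrivial with hs | hs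
  · exact ⟨1, one_pos, fun i j hij => absurd (hs ⟨i, rfl⟩ ⟨j, rfl⟩) hij⟩
  · refine ⟨(Set.range c).infsep, hfin.infsep_pos_iff_nontrivial.2 hs, fun i j hij => ?_⟩
    rw [← dist_eq_norm]
    exact Set.infsep_le_dist_of_mem ⟨i, rfl⟩ ⟨j, rfl⟩ hij

/-- Cluster points `x̂` of the primal iterates are in consensus. Otherwise, from a time at which the
dual iterate is close to its cluster point `ŵ`, the quantity `∑ i, ⟪w i - ŵ i, x̂ i⟫` is preserved
until a link joins nodes at which `x̂` differs, and that link causes a decrease of `V` that is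
bounded below. -/
theorem eq_of_clusterPt_of_connected {n : ℕ} {E : Type*} [NormedAddCommGroup E]
    [InnerProductSpace ℝ E] {G : ℕ → SimpleGraph (Fin n)} (hG : (infiniteLinks G).Connected)
    {h : ℕ → Fin n → Fin n → ℝ} {hlow : ℝ} (hlow_pos : 0 < hlow)
    (hsymm : ∀ k i j, (G k).Adj i j → h k i j = h k j i)
    (hbound : ∀ k i j, (G k).Adj i j → hlow ≤ h k i j)
    {θ : Fin n → ℝ} (hθ : ∀ i, 0 < θ i) {α V : ℕ → ℝ} {w x : ℕ → Fin n → E} {c D : ℝ}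
    (hc : 0 < c)
    (hstep : ∀ k i, w (k + 1) i =
      w k i - α k • ∑ j, linkWeight (G k) (h k) i j • (x k i - x k j))
    (hdec : ∀ k, V (k + 1) + c * laplacianForm (linkWeight (G k) (h k)) (x k) (x k) ≤ V k)
    {what xhat : Fin n → E}
    (hV : ∀ k, D + ∑ i, ⟪w k i - what i, xhat i⟫_ℝ + ∑ i, θ i / 2 * ‖x k i - xhat i‖ ^ 2 ≤ V k)
    (hDV : ∀ k, D ≤ V k)
    {φ : ℕ → ℕ} (hVφ : Tendsto (V ∘ φ) atTop (𝓝 D))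
    (hwφ : ∀ i, Tendsto (fun m => w (φ m) i) atTop (𝓝 (what i))) (i j : Fin n) :
    xhat i = xhat j := by
  by_contra hne
  have ha0 : ∀ k i j, 0 ≤ linkWeight (G k) (h k) i j := fun k =>
    linkWeight_nonneg fun i j hij => hlow_pos.le.trans (hbound k i j hij)
  obtain ⟨i0, j0, hadj0, hne0⟩ : ∃ i j, (infiniteLinks G).Adj i j ∧ xhat i ≠ xhat j := by
    by_contra! hcon
    exact hne (hG.eq_of_forall_adj hcon i j)
  obtain ⟨ε, hε, hsep⟩ := exists_pos_le_norm_sub xhat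
  have : Nonempty (Fin n) := ⟨i⟩
  obtain ⟨iθ, hiθ⟩ := Finite.exists_min θ
  set s : ℕ → ℝ := fun k => ∑ i, ⟪w k i - what i, xhat i⟫_ℝ with hs
  have hsφ : Tendsto (s ∘ φ) atTop (𝓝 0) := by
    have : Tendsto (s ∘ φ) atTop (𝓝 (∑ i, ⟪what i - what i, xhat i⟫_ℝ)) :=
      tendsto_finsetSum _ fun i _ => ((hwφ i).sub_const _).inner tendsto_const_nhds
    simpa using this
  have hgap : Tendsto (fun m => V (φ m) - D - s (φ m)) atTop (𝓝 0) := by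
    simpa using (hVφ.sub_const D).sub hsφ
  have hgap' : Tendsto (fun m => V (φ m) - D) atTop (𝓝 0) := by
    simpa using hVφ.sub_const D
  -- The first threshold forces `x` within `ε / 4` of `xhat`; the second is the least drop caused by
  -- a link whose ends are `ε / 2` apart.
  obtain ⟨m, hm1, hm2⟩ := ((hgap.eventually_lt_const
    (show (0 : ℝ) < θ iθ / 2 * (ε / 4) ^ 2 by have := hθ iθ; positivity)).and
    (hgap'.eventually_lt_const (show (0 : ℝ) < c * (2⁻¹ * (hlow * (ε / 2) ^ 2)) by positivity))).exists
  have hanti : Antitone V := antitone_nat_of_succ_le fun k => by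
    have := hdec k
    have := mul_nonneg hc.le (laplacianForm_self_nonneg (ha0 k) (x k))
    linarith
  classical
  have hex : ∃ t, ∃ i j, (G (φ m + t)).Adj i j ∧ xhat i ≠ xhat j := by
    obtain ⟨k, hk, hkadj⟩ := frequently_atTop.1 (frequently_adj_of_infiniteLinks_adj hadj0) (φ m)
    exact ⟨k - φ m, i0, j0, by rwa [Nat.add_sub_cancel' hk], hne0⟩
  obtain ⟨i1, j1, hadj1, hne1⟩ := Nat.find_spec hex
  -- The bound includes the first separating time itself: `s` there depends only on earlier links,
  -- all joining equal values of `xhat`.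
  have hconst : ∀ t ≤ Nat.find hex, s (φ m + t) = s (φ m) := by
    intro t
    induction t with
    | zero => intro _; rfl
    | succ t ih =>
      intro ht
      rw [← ih (by omega)]
      have hno := Nat.find_min hex (m := t) (by omega)
      push Not at hno
      have h1 : laplacianForm (linkWeight (G (φ m + t)) (h (φ m + t))) (x (φ m + t)) xhat = 0 := by
        rw [laplacianForm]
        refine mul_eq_zero_of_right _ (Finset.sum_eq_zero fun i _ => Finset.sum_eq_zero fun j _ => ?_)
        by_cases hij : (G (φ m + t)).Adj i j
        · rw [hno i j hij, sub_self, inner_zero_right, mul_zero]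
        · rw [linkWeight, if_neg hij, zero_mul]
      rw [← sum_inner_laplacian (linkWeight_symm (hsymm _))] at h1
      have h2 : ∀ i, ⟪w (φ m + t + 1) i - what i, xhat i⟫_ℝ =
          ⟪w (φ m + t) i - what i, xhat i⟫_ℝ - α (φ m + t) *
            ⟪∑ j, linkWeight (G (φ m + t)) (h (φ m + t)) i j •
              (x (φ m + t) i - x (φ m + t) j), xhat i⟫_ℝ := by
        intro i
        rw [hstep, sub_right_comm, inner_sub_left, real_inner_smul_left]
      rw [← add_assoc]
      simp only [hs, h2, Finset.sum_sub_distrib, ← Finset.mul_sum, h1, mul_zero, sub_zero]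
  set k := φ m + Nat.find hex with hk
  have hVk : V k ≤ V (φ m) := hanti (Nat.le_add_right _ _)
  -- `s` is unchanged and `V` has not increased since time `φ m`, so `V - D - s` is still below the
  -- first threshold.
  have hclose : ∀ i, ‖x k i - xhat i‖ ≤ ε / 4 := by
    intro i
    have h1 := hV k
    have h2 : s k = s (φ m) := hconst _ le_rfl
    have h3 : θ i / 2 * ‖x k i - xhat i‖ ^ 2 ≤ ∑ i, θ i / 2 * ‖x k i - xhat i‖ ^ 2 :=
      Finset.single_le_sum (f := fun i => θ i / 2 * ‖x k i - xhat i‖ ^ 2)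
        (fun i _ => by have := hθ i; positivity) (Finset.mem_univ i)
    have h4 : θ iθ / 2 * ‖x k i - xhat i‖ ^ 2 ≤ θ i / 2 * ‖x k i - xhat i‖ ^ 2 := by
      gcongr; exact hiθ i
    have h5 : θ iθ / 2 * ‖x k i - xhat i‖ ^ 2 ≤ θ iθ / 2 * (ε / 4) ^ 2 := by
      change D + s k + _ ≤ _ at h1
      linarith
    have h6 := le_of_mul_le_mul_left h5 (half_pos (hθ iθ))
    exact le_of_sq_le_sq h6 (by positivity)
  have hfar : ε / 2 ≤ ‖x k i1 - x k j1‖ := by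
    have h1 := hsep i1 j1 hne1
    have h2 : xhat i1 - xhat j1 =
        (x k i1 - x k j1) - (x k i1 - xhat i1) + (x k j1 - xhat j1) := by abel
    have h3 := norm_add_le ((x k i1 - x k j1) - (x k i1 - xhat i1)) (x k j1 - xhat j1)
    have h4 := norm_sub_le (x k i1 - x k j1) (x k i1 - xhat i1)
    rw [← h2] at h3
    linarith [hclose i1, hclose j1]
  have hq := le_laplacianForm_self (ha0 k) (x k) i1 j1
  have hw1 : hlow ≤ linkWeight (G k) (h k) i1 j1 := by
    rw [linkWeight, if_pos hadj1]; exact hbound k i1 j1 hadj1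
  have hdrop : c * (2⁻¹ * (hlow * (ε / 2) ^ 2)) ≤
      c * laplacianForm (linkWeight (G k) (h k)) (x k) (x k) := by
    refine mul_le_mul_of_nonneg_left (le_trans ?_ hq) hc.le
    have := ha0 k i1 j1
    gcongr
  -- The drop exceeds `V k - D`, contradicting `D ≤ V (k + 1)`.
  linarith [hdec k, hDV (k + 1)]

/-! ### Descent, boundedness and cluster points of the iterates -/

namespace IsFenchelDualGradient

variable {n d : ℕ} {f : Fin n → Dec d → ℝ} {X : Fin n → Set (Dec d)} {θ : Fin n → ℝ}
  {G : ℕ → SimpleGraph (Fin n)} {h : ℕ → Fin n → Fin n → ℝ} {α : ℕ → ℝ} {w x : ℕ → Stacked n d}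

theorem step_eq (hwx : IsFenchelDualGradient f X G h α w x) (k : ℕ) (i : Fin n) :
    w (k + 1) i = w k i - α k • ∑ j, linkWeight (G k) (h k) i j • (x k i - x k j) := by
  rw [hwx.dual_step k i, Finset.sum_filter]
  simp only [linkWeight, ite_smul, zero_smul]

theorem dualObj_eq (hwx : IsFenchelDualGradient f X G h α w x) (k : ℕ) :
    dualObj f X (w k) = ∑ i, conjObj (f i) (x k i) (w k i) :=
  Finset.sum_congr rfl fun i _ => conjFun_eq_of_isMaxOn (hwx.primal_mem k i) (hwx.primal_max k i)

theorem sum_dual_eq_zero (hwx : IsFenchelDualGradient f X G h α w x)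
    (hsymm : ∀ k i j, (G k).Adj i j → h k i j = h k j i) (k : ℕ) : ∑ i, w k i = 0 := by
  induction k with
  | zero => exact hwx.init
  | succ k ih =>
    have h1 : ∑ i, ∑ j, linkWeight (G k) (h k) i j • (x k i - x k j) = 0 := by
      simp only [smul_sub, Finset.sum_sub_distrib]
      rw [sub_eq_zero, Finset.sum_comm]
      exact Finset.sum_congr rfl fun i _ => Finset.sum_congr rfl fun j _ => by
        rw [linkWeight_symm (hsymm k)]
    simp only [hwx.step_eq, Finset.sum_sub_distrib, ← Finset.smul_sum, h1, ih, smul_zero, sub_zero]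

/-- Sufficient decrease of the dual objective along the iterates. -/
theorem dualObj_succ_add_le (hwx : IsFenchelDualGradient f X G h α w x)
    (hθ : ∀ i, 0 < θ i) (hf : ∀ i, StrongConvexOn (X i) (θ i) (f i))
    (hsymm : ∀ k i j, (G k).Adj i j → h k i j = h k j i)
    (hnn : ∀ k i j, (G k).Adj i j → 0 ≤ h k i j)
    {δ : ℝ} (hδ_pos : 0 < δ)
    (hδ : ∀ k, (δ • (Matrix.diagonal fun i => 1 / θ i)⁻¹ - weightMatrix (G k) (h k)).PosSemidef)
    {αlow αhigh : ℝ} (hαlow : 0 < αlow) (hαhigh : αhigh < 2 / δ)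
    (hα : ∀ k, α k ∈ Set.Icc αlow αhigh) (k : ℕ) :
    dualObj f X (w (k + 1)) +
      αlow * (1 - αhigh * δ / 2) * laplacianForm (linkWeight (G k) (h k)) (x k) (x k) ≤
      dualObj f X (w k) := by
  set a := linkWeight (G k) (h k) with ha
  set q := laplacianForm a (x k) (x k) with hq
  have hsa : ∀ i j, a i j = a j i := linkWeight_symm (hsymm k)
  have hna : ∀ i j, 0 ≤ a i j := linkWeight_nonneg (hnn k)
  have hq0 : 0 ≤ q := laplacianForm_self_nonneg hna _
  set g : Fin n → Dec d := fun i => ∑ j, a i j • (x k i - x k j) with hg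
  have hdiff : ∀ i, w (k + 1) i - w k i = -(α k • g i) := fun i => by
    rw [hwx.step_eq]; abel
  have hgx : ∑ i, ⟪g i, x k i⟫_ℝ = q := sum_inner_laplacian hsa _ _
  have hgg : ∑ i, (θ i)⁻¹ * ‖g i‖ ^ 2 ≤ δ * q :=
    sum_norm_sq_laplacian_le hsa hna hθ hδ_pos (laplacianForm_linkWeight_le (hsymm k) hθ (hδ k)) _
  have hub : dualObj f X (w (k + 1)) ≤
      dualObj f X (w k) - α k * q + α k ^ 2 / 2 * ∑ i, (θ i)⁻¹ * ‖g i‖ ^ 2 := by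
    rw [hwx.dualObj_eq, hwx.dualObj_eq, ← hgx, Finset.mul_sum, Finset.mul_sum,
      ← Finset.sum_sub_distrib, ← Finset.sum_add_distrib]
    refine Finset.sum_le_sum fun i _ => ?_
    refine ((hf i).conjObj_le_add_sq (hθ i) (hwx.primal_mem k i) (hwx.primal_max k i)
      (hwx.primal_mem (k + 1) i) (w (k + 1) i)).trans_eq ?_
    have := (hθ i).ne'
    rw [hdiff, inner_neg_left, real_inner_smul_left, norm_neg, norm_smul, mul_pow,
      Real.norm_eq_abs, sq_abs]
    field_simp
    ring
  obtain ⟨h1, h2⟩ := hα k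
  rw [lt_div_iff₀ hδ_pos] at hαhigh
  have h3 : α k ^ 2 / 2 * ∑ i, (θ i)⁻¹ * ‖g i‖ ^ 2 ≤ α k ^ 2 / 2 * (δ * q) := by gcongr
  -- Each factor is bounded separately; `αhigh < 2 / δ` makes the second lower bound positive.
  have h4 : αlow * (1 - αhigh * δ / 2) ≤ α k * (1 - α k * δ / 2) := by
    have h5 : 1 - αhigh * δ / 2 ≤ 1 - α k * δ / 2 := by gcongr
    exact mul_le_mul h1 h5 (by linarith) (hαlow.le.trans h1)
  have h6 := mul_le_mul_of_nonneg_right h4 hq0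
  linarith

/-- The dual iterates remain in a bounded set. -/
theorem exists_norm_dual_le (hwx : IsFenchelDualGradient f X G h α w x)
    (hf : ∀ i, ConvexOn ℝ (X i) (f i)) (h0 : ∀ i, (0 : Dec d) ∈ interior (X i))
    (hanti : Antitone fun k => dualObj f X (w k)) :
    ∃ R, ∀ k i, ‖w k i‖ ≤ R := by
  choose r hr M hM using fun i => (hf i).exists_mul_norm_sub_le_conjObj (h0 i)
  have key : ∀ k i, ‖w k i‖ ≤ (dualObj f X (w 0) + ∑ j, M j) / r i := by
    intro k i
    rw [le_div_iff₀ (hr i)]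
    have h1 : dualObj f X (w k) ≤ dualObj f X (w 0) := hanti (Nat.zero_le k)
    have h2 : ∑ j, (r j * ‖w k j‖ - M j) ≤ dualObj f X (w k) := by
      rw [hwx.dualObj_eq]
      exact Finset.sum_le_sum fun j _ => hM j _ _ (hwx.primal_max k j)
    have h3 : r i * ‖w k i‖ ≤ ∑ j, r j * ‖w k j‖ :=
      Finset.single_le_sum (f := fun j => r j * ‖w k j‖)
        (fun j _ => mul_nonneg (hr j).le (norm_nonneg _)) (Finset.mem_univ i)
    rw [Finset.sum_sub_distrib] at h2
    linarith
  obtain ⟨R, hR⟩ := Finite.bddAbove_range fun i => (dualObj f X (w 0) + ∑ j, M j) / r i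
  exact ⟨R, fun k i => (key k i).trans (hR ⟨i, rfl⟩)⟩

/-- Bounded dual iterates have a cluster point, at which the primal iterates converge along the
same subsequence to the maximizers. -/
theorem exists_clusterPt (hwx : IsFenchelDualGradient f X G h α w x)
    (hX : ∀ i, IsClosed (X i)) (hθ : ∀ i, 0 < θ i)
    (hf : ∀ i, StrongConvexOn (X i) (θ i) (f i))
    (hlsc : ∀ i, LowerSemicontinuousOn (f i) (X i)) {R : ℝ} (hR : ∀ k i, ‖w k i‖ ≤ R) :
    ∃ (what xhat : Fin n → Dec d) (φ : ℕ → ℕ), StrictMono φ ∧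
      (∀ i, Tendsto (fun m => w (φ m) i) atTop (𝓝 (what i))) ∧
      (∀ i, xhat i ∈ X i) ∧ ∀ i, IsMaxOn (fun y => conjObj (f i) y (what i)) (X i) (xhat i) := by
  -- Dual iterates are at most `2 * R` apart, and maximizers are `1 / θ i`-Lipschitz.
  have hx : ∀ k i, x k i ∈ Metric.closedBall (x 0 i) (2 * R / θ i) := by
    intro k i
    rw [Metric.mem_closedBall, dist_eq_norm, le_div_iff₀ (hθ i), mul_comm]
    refine ((hf i).norm_sub_le_of_isMaxOn (hwx.primal_mem 0 i) (hwx.primal_max 0 i)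
      (hwx.primal_mem k i) (hwx.primal_max k i)).trans ?_
    linarith [norm_sub_le (w k i) (w 0 i), hR k i, hR 0 i]
  have hcomp : IsCompact (Set.univ.pi fun i : Fin n =>
      Metric.closedBall (0 : Dec d) R ×ˢ Metric.closedBall (x 0 i) (2 * R / θ i)) :=
    isCompact_univ_pi fun i => (isCompact_closedBall _ _).prod (isCompact_closedBall _ _)
  obtain ⟨p, -, φ, hφ, hp⟩ := hcomp.tendsto_subseq (x := fun k i => (w k i, x k i))
    fun k i _ => ⟨mem_closedBall_zero_iff.2 (hR k i), hx k i⟩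
  have hp' := tendsto_pi_nhds.1 hp
  have hw : ∀ i, Tendsto (fun m => w (φ m) i) atTop (𝓝 (p i).1) := fun i =>
    (continuous_fst.tendsto _).comp (hp' i)
  have hx' : ∀ i, Tendsto (fun m => x (φ m) i) atTop (𝓝 (p i).2) := fun i =>
    (continuous_snd.tendsto _).comp (hp' i)
  have hmax := fun i => (hlsc i).isMaxOn_conjObj_of_tendsto (hX i)
    (fun m => hwx.primal_mem (φ m) i) (fun m => hwx.primal_max (φ m) i) (hw i) (hx' i)
  exact ⟨fun i => (p i).1, fun i => (p i).2, φ, hφ, hw, fun i => (hmax i).1, fun i => (hmax i).2⟩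

end IsFenchelDualGradient

/-! ### Duality inequalities -/

section Duality

variable {n d : ℕ} {f : Fin n → Dec d → ℝ} {X : Fin n → Set (Dec d)} {θ : Fin n → ℝ}

/-- Strong lower bound on the dual objective by its linearization. -/
theorem sum_conjObj_add_le {w w' x x' : Fin n → Dec d}
    (hf : ∀ i, StrongConvexOn (X i) (θ i) (f i)) (hx : ∀ i, x i ∈ X i) (hx' : ∀ i, x' i ∈ X i)
    (hmax' : ∀ i, IsMaxOn (fun y => conjObj (f i) y (w' i)) (X i) (x' i)) :
    ∑ i, conjObj (f i) (x i) (w i) + ∑ i, ⟪w' i - w i, x i⟫_ℝ +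
      ∑ i, θ i / 2 * ‖x' i - x i‖ ^ 2 ≤ ∑ i, conjObj (f i) (x' i) (w' i) := by
  rw [← Finset.sum_add_distrib, ← Finset.sum_add_distrib]
  refine Finset.sum_le_sum fun i _ => ?_
  rw [← conjObj_eq_add_inner, norm_sub_rev]
  exact (hf i).conjObj_add_le (hx' i) (hmax' i) (hx i)

/-- The linear terms cancel at a common point. This yields weak duality on `Sᗮ`, and equality at the
cluster point. -/
theorem sum_conjObj_const {w : Fin n → Dec d} (hw : ∑ i, w i = 0) (z : Dec d) :
    ∑ i, conjObj (f i) z (w i) = -∑ i, f i z := by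
  simp only [conjObj, Finset.sum_sub_distrib, ← sum_inner, hw, inner_zero_left, zero_sub]

end Duality

/-! ### Main theorem -/

theorem theorem1 {n d : ℕ}
    -- the problem: local objectives, constraint sets and convexity parameters
    (f : Fin n → Dec d → ℝ) (X : Fin n → Set (Dec d)) (θ : Fin n → ℝ)
    (hX : ∀ i, IsClosed (X i))
    (hθ : ∀ i, 0 < θ i)
    (hf : ∀ i, StrongConvexOn (X i) (θ i) (f i))
    (hlsc : ∀ i, LowerSemicontinuousOn (f i) (X i))
    (h0 : (0 : Dec d) ∈ interior (⋂ i, X i))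
    -- the time-varying network: infinite connectivity
    (G : ℕ → SimpleGraph (Fin n))
    (hG : (infiniteLinks G).Connected)
    -- the link weights
    (h : ℕ → Fin n → Fin n → ℝ) (hlow hhigh : ℝ) (hlow_pos : 0 < hlow)
    (hsymm : ∀ k i j, (G k).Adj i j → h k i j = h k j i)
    (hbound : ∀ k i j, (G k).Adj i j → h k i j ∈ Set.Icc hlow hhigh)
    -- the step-sizes
    (δ : ℝ) (hδ_pos : 0 < δ)
    (hδ : ∀ k, (δ • (Matrix.diagonal fun i => 1 / θ i)⁻¹ - weightMatrix (G k) (h k)).PosSemidef)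
    (α : ℕ → ℝ) (αlow αhigh : ℝ) (hαlow : 0 < αlow) (hαhigh : αhigh < 2 / δ)
    (hα : ∀ k, α k ∈ Set.Icc αlow αhigh)
    -- the iterates
    (w x : ℕ → Stacked n d) (hwx : IsFenchelDualGradient f X G h α w x) :
    ∃ (xstar : Dec d) (Fstar Dstar : ℝ),
      -- the unique optimal solution
      (xstar ∈ ⋂ i, X i) ∧
      IsMinOn (fun y => ∑ i, f i y) (⋂ i, X i) xstar ∧
      (∀ y ∈ ⋂ i, X i, IsMinOn (fun z => ∑ i, f i z) (⋂ i, X i) y → y = xstar) ∧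
      -- the primal and dual optimal values
      IsLeast (primalObj f '' feasibleSet X) Fstar ∧
      IsLeast (dualObj f X '' (((consensus n d)ᗮ : Submodule ℝ (Stacked n d)) :
        Set (Stacked n d))) Dstar ∧
      -- convergence
      Tendsto (fun k => ‖(consensus n d)ᗮ.starProjection (x k)‖) atTop (𝓝 0) ∧
      Tendsto (fun k => dualObj f X (w k)) atTop (𝓝 Dstar) ∧
      Tendsto (fun k => primalObj f (x k)) atTop (𝓝 Fstar) ∧
      Tendsto x atTop (𝓝 (WithLp.toLp 2 fun _ => xstar)) := by
  have hsub : ∀ i, (⋂ i, X i) ⊆ X i := fun i => Set.iInter_subset X i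
  have hdec := hwx.dualObj_succ_add_le hθ hf hsymm
    (fun k i j hij => hlow_pos.le.trans (hbound k i j hij).1) hδ_pos hδ hαlow hαhigh hα
  have hc : 0 < αlow * (1 - αhigh * δ / 2) := by
    rw [lt_div_iff₀ hδ_pos] at hαhigh
    exact mul_pos hαlow (by linarith)
  have hanti : Antitone fun k => dualObj f X (w k) := antitone_nat_of_succ_le fun k => by
    have h1 := laplacianForm_self_nonneg (linkWeight_nonneg fun i j hij =>
      hlow_pos.le.trans (hbound k i j hij).1) (x k)
    have h2 := mul_nonneg hc.le h1
    linarith [hdec k]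
  obtain ⟨R, hR⟩ := hwx.exists_norm_dual_le
    (fun i => (hf i).convexOn fun r => by have := hθ i; simp only [Pi.zero_apply]; positivity)
    (fun i => interior_mono (hsub i) h0) hanti
  obtain ⟨what, xhat, φ, hφ, hwφ, hxhat, hmax⟩ := hwx.exists_clusterPt hX hθ hf hlsc hR
  set D := ∑ i, conjObj (f i) (xhat i) (what i) with hD
  have hV : ∀ k, D + ∑ i, ⟪w k i - what i, xhat i⟫_ℝ + ∑ i, θ i / 2 * ‖x k i - xhat i‖ ^ 2 ≤
      dualObj f X (w k) := fun k => by
    rw [hwx.dualObj_eq]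
    exact sum_conjObj_add_le hf hxhat (hwx.primal_mem k) (hwx.primal_max k)
  -- `D` is the dual value at `what`; the linearization there bounds the dual objective below, and
  -- the descent inequality bounds it above.
  have hVφ : Tendsto ((fun k => dualObj f X (w k)) ∘ φ) atTop (𝓝 D) := by
    have hlo : Tendsto (fun m => D + ∑ i, ⟪w (φ m) i - what i, xhat i⟫_ℝ) atTop (𝓝 D) := by
      have : Tendsto (fun m => D + ∑ i, ⟪w (φ m) i - what i, xhat i⟫_ℝ) atTop
          (𝓝 (D + ∑ i, ⟪what i - what i, xhat i⟫_ℝ)) :=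
        tendsto_const_nhds.add (tendsto_finsetSum _ fun i _ =>
          ((hwφ i).sub_const _).inner tendsto_const_nhds)
      simpa using this
    have hhi : Tendsto (fun m => ∑ i, (conjObj (f i) (xhat i) (what i) +
        ⟪w (φ m) i - what i, xhat i⟫_ℝ + 1 / (2 * θ i) * ‖w (φ m) i - what i‖ ^ 2))
        atTop (𝓝 D) := by
      have : Tendsto (fun m => ∑ i, (conjObj (f i) (xhat i) (what i) +
          ⟪w (φ m) i - what i, xhat i⟫_ℝ + 1 / (2 * θ i) * ‖w (φ m) i - what i‖ ^ 2)) atTop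
          (𝓝 (∑ i, (conjObj (f i) (xhat i) (what i) +
          ⟪what i - what i, xhat i⟫_ℝ + 1 / (2 * θ i) * ‖what i - what i‖ ^ 2))) :=
        tendsto_finsetSum _ fun i _ =>
          (tendsto_const_nhds.add (((hwφ i).sub_const _).inner tendsto_const_nhds)).add
            ((((hwφ i).sub_const _).norm.pow 2).const_mul _)
      simpa using this
    refine tendsto_of_tendsto_of_tendsto_of_le_of_le hlo hhi (fun m => ?_) fun m => ?_
    · refine le_trans ?_ (hV (φ m))
      exact le_add_of_nonneg_right (Finset.sum_nonneg fun i _ => by have := hθ i; positivity)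
    · simp only [Function.comp_apply, hwx.dualObj_eq]
      exact Finset.sum_le_sum fun i _ => (hf i).conjObj_le_add_sq (hθ i) (hxhat i) (hmax i)
        (hwx.primal_mem _ i) _
  have hDV : ∀ k, D ≤ dualObj f X (w k) := fun k =>
    le_of_tendsto hVφ ((hφ.tendsto_atTop.eventually_ge_atTop k).mono fun m hm => hanti hm)
  -- A monotone bounded sequence converges to its infimum, which the subsequence identifies as `D`.
  have hVlim : Tendsto (fun k => dualObj f X (w k)) atTop (𝓝 D) :=
    tendsto_nhds_unique (tendsto_atTop_ciInf hanti ⟨D, Set.forall_mem_range.2 hDV⟩ |>.comp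
      hφ.tendsto_atTop) hVφ ▸ tendsto_atTop_ciInf hanti ⟨D, Set.forall_mem_range.2 hDV⟩
  have hcons : ∀ i j, xhat i = xhat j :=
    eq_of_clusterPt_of_connected hG hlow_pos hsymm (fun k i j hij => (hbound k i j hij).1) hθ hc
      (w := fun k i => w k i) (x := fun k i => x k i) hwx.step_eq hdec hV hDV hVφ hwφ
  obtain ⟨i0⟩ := hG.nonempty
  obtain ⟨xstar, hxs⟩ : ∃ z, ∀ i, xhat i = z := ⟨xhat i0, fun i => hcons i i0⟩
  obtain rfl : xhat = fun _ => xstar := funext hxs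
  have hsum : ∀ k, ∑ i, w k i = 0 := hwx.sum_dual_eq_zero hsymm
  have hsumhat : ∑ i, what i = 0 := by
    refine tendsto_nhds_unique (tendsto_finsetSum _ fun i _ => hwφ i) ?_
    simp only [hsum, tendsto_const_nhds]
  have hDF : D = -∑ i, f i xstar := sum_conjObj_const hsumhat xstar
  -- Sum the sharp bounds at `what`: its blocks sum to zero, so the multiplier disappears.
  -- Optimality and uniqueness both follow.
  have hgrow : ∀ z ∈ ⋂ i, X i, ∑ i, f i xstar + ∑ i, θ i / 2 * ‖z - xstar‖ ^ 2 ≤ ∑ i, f i z := by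
    intro z hz
    have h1 := Finset.sum_le_sum fun i (_ : i ∈ Finset.univ) =>
      (hf i).conjObj_add_le (hxhat i) (hmax i) (hsub i hz)
    rw [Finset.sum_add_distrib, sum_conjObj_const hsumhat, sum_conjObj_const hsumhat] at h1
    linarith
  have hθsum : 0 < ∑ i, θ i / 2 := Finset.sum_pos (fun i _ => half_pos (hθ i)) ⟨i0, Finset.mem_univ _⟩
  have hmem : xstar ∈ ⋂ i, X i := Set.mem_iInter.2 hxhat
  have hmin : ∀ z ∈ ⋂ i, X i, ∑ i, f i xstar ≤ ∑ i, f i z := fun z hz => by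
    refine le_trans (le_add_of_nonneg_right ?_) (hgrow z hz)
    exact Finset.sum_nonneg fun i _ => by have := hθ i; positivity
  have hcross : ∀ k, ∑ i, ⟪w k i, xstar⟫_ℝ = 0 := fun k => by
    rw [← sum_inner, hsum, inner_zero_left]
  have hxlim : ∀ i, Tendsto (fun k => x k i) atTop (𝓝 xstar) := by
    intro i
    rw [tendsto_iff_norm_sub_tendsto_zero]
    have h1 : Tendsto (fun k => Real.sqrt (2 / θ i * (dualObj f X (w k) - D))) atTop (𝓝 0) := by
      have : Tendsto (fun k => Real.sqrt (2 / θ i * (dualObj f X (w k) - D))) atTop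
          (𝓝 (Real.sqrt (2 / θ i * (D - D)))) :=
        ((hVlim.sub_const D).const_mul _).sqrt
      simpa using this
    refine squeeze_zero (fun k => norm_nonneg _) (fun k => Real.le_sqrt_of_sq_le ?_) h1
    have h2 := hV k
    have h3 : ∑ i, ⟪w k i - what i, xstar⟫_ℝ = 0 := by
      rw [← sum_inner, Finset.sum_sub_distrib, hsum, hsumhat, sub_zero, inner_zero_left]
    have h4 : θ i / 2 * ‖x k i - xstar‖ ^ 2 ≤ ∑ i, θ i / 2 * ‖x k i - xstar‖ ^ 2 :=
      Finset.single_le_sum (f := fun i => θ i / 2 * ‖x k i - xstar‖ ^ 2)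
        (fun i _ => by have := hθ i; positivity) (Finset.mem_univ i)
    have hθi := hθ i
    rw [div_mul_eq_mul_div, le_div_iff₀ hθi]
    linarith
  have hxlim' : Tendsto x atTop (𝓝 (WithLp.toLp 2 fun _ => xstar)) := by
    have h1 : Tendsto (fun k => (x k).ofLp) atTop (𝓝 fun _ => xstar) := tendsto_pi_nhds.2 hxlim
    exact ((PiLp.continuous_toLp 2 _).tendsto _).comp h1
  have hstar : (WithLp.toLp 2 fun _ => xstar : Stacked n d) ∈ consensus n d := fun _ _ => rfl
  refine ⟨xstar, ∑ i, f i xstar, D, hmem, fun z hz => hmin z hz, fun y hy hy' => ?_, ⟨?_, ?_⟩,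
    ⟨?_, ?_⟩, ?_, hVlim, ?_, hxlim'⟩
  · have h1 := hgrow y hy
    have h2 : ∑ i, f i y ≤ ∑ i, f i xstar := hy' hmem
    rw [← Finset.sum_mul] at h1
    have h3 : (∑ i, θ i / 2) * ‖y - xstar‖ ^ 2 ≤ 0 := by linarith
    have h4 : ‖y - xstar‖ ^ 2 = 0 :=
      le_antisymm (nonpos_of_mul_nonpos_right h3 hθsum) (sq_nonneg _)
    exact sub_eq_zero.1 (norm_eq_zero.1 (pow_eq_zero_iff two_ne_zero |>.1 h4))
  · exact ⟨WithLp.toLp 2 fun _ => xstar, ⟨hxhat, hstar⟩, rfl⟩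
  · rintro _ ⟨y, ⟨hy, hyc⟩, rfl⟩
    have h1 : ∀ i, y i = y i0 := fun i => hyc i i0
    have h2 := hmin (y i0) (Set.mem_iInter.2 fun i => h1 i ▸ hy i)
    simpa only [primalObj, h1] using h2
  · refine ⟨WithLp.toLp 2 what, mem_orthogonal_consensus_iff.2 hsumhat, ?_⟩
    exact Finset.sum_congr rfl fun i _ => conjFun_eq_of_isMaxOn (hxhat i) (hmax i)
  · rintro _ ⟨v, hv, rfl⟩
    rw [hDF, ← sum_conjObj_const (mem_orthogonal_consensus_iff.1 hv) xstar]
    exact Finset.sum_le_sum fun i _ => le_ciSup (f := fun y : X i => conjObj (f i) y (v i))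
      (bddAbove_range_conjObj (hθ i) (hf i) (hxhat i) (hmax i) (v i)) ⟨xstar, hxhat i⟩
  · have h1 := (((consensus n d)ᗮ.starProjection.continuous.tendsto _).comp hxlim').norm
    rwa [(Submodule.starProjection_apply_eq_zero_iff _).2
      (Submodule.le_orthogonal_orthogonal _ hstar), norm_zero] at h1
  -- Subtracting `xstar` is free by `hcross`; the inner products then vanish in the limit because
  -- the `w k` are bounded. No continuity of `f` is needed.
  · have h1 : ∀ k, primalObj f (x k) = ∑ i, ⟪w k i, x k i - xstar⟫_ℝ - dualObj f X (w k) := by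
      intro k
      simp only [hwx.dualObj_eq, conjObj, inner_sub_right, Finset.sum_sub_distrib, hcross, primalObj]
      ring
    have h2 : Tendsto (fun k => ∑ i, ⟪w k i, x k i - xstar⟫_ℝ) atTop (𝓝 0) := by
      have h3 : ∀ i, Tendsto (fun k => ⟪w k i, x k i - xstar⟫_ℝ) atTop (𝓝 0) := fun i =>
        squeeze_zero_norm (a := fun k => R * ‖x k i - xstar‖)
          (fun k => (norm_inner_le_norm _ _).trans (by gcongr; exact hR k i))
          (by simpa using (tendsto_iff_norm_sub_tendsto_zero.1 (hxlim i)).const_mul R)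
      simpa using tendsto_finsetSum Finset.univ fun i _ => h3 i
    have h3 := h2.sub hVlim
    rw [hDF, zero_sub, neg_neg] at h3
    exact h3.congr fun k => (h1 k).symm
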